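/- Let $C_1,C_2,C_3\in\mathbb R$ with $2C_1+C_2>0$ and $0<C_3<C_{3,critical}:=\frac1{27}(2C_1+C_2)^3$, and let $$U(\phi)=-\tfrac12\phi^2-\tfrac12C_2\phi-\tfrac12C_1C_2-\frac{C_3}{2(\phi-C_1)},\qquad \phi\neq C_1.$$ (The smooth periodic travelling waves of the Dullin–Gottwald–Holm equation satisfy $b=\frac12(d\phi/dz)^2+U(\phi)$, where $b$ is a constant of integration and $z$ is the rescaled travelling-wave variable.) Then $U$ has exactly three critical points $\phi_1<\phi_2<\phi_3$, and $-\frac{C_2}{2}<\phi_1<\frac{C_1-C_2}{3}<\phi_2<C_1<\phi_3$. Put $b_-=U(\phi_2)$ and $b_+=U(\phi_1)$; then $b_-<b_+$. For every $b\in(b_-,b_+)$ the equation $U(\phi)=b$ has exactly two solutions $\phi_-(b)<\phi_+(b)$ in $(\phi_1,C_1)$ (the turning points); they satisfy $\phi_1<\phi_-(b)<\phi_2<\phi_+(b)<C_1$, one has $U<b$ on $(\phi_-(b),\phi_+(b))$, and the integral $$\mathfrak L(C_1,C_2,C_3,b)=2\int_{\phi_-(b)}^{\phi_+(b)}\sqrt{\frac{1}{2\,[\,b-U(\phi)\,]}}\;d\phi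 ,$$ which defines the period function of the smooth periodic waves, converges. For fixed $C_1,C_2,C_3$ as above, the period function $b\mapsto\mathfrak L(C_1,C_2,C_3,b)$ is strictly increasing on $(b_-,b_+)$. -/

import Mathlib

/-! Notions for the smooth periodic travelling waves of the Dullin–Gottwald–Holm equation, written
as Newton's equation `b = (1/2) (dφ/dz)^2 + U φ` with total energy `b`. -/

namespace DGH

noncomputable section

/-- The potential energy `U` of the travelling wave equation; `φ = C₁` is its pole. -/
def U (C₁ C₂ C₃ φ : ℝ) : ℝ :=
  -(1 / 2) * φ ^ 2 - (1 / 2) * C₂ * φ - (1 / 2) * C₁ * C₂ - C₃ / (2 * (φ - C₁))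

/-- The critical value of `C₃`. -/
def C₃critical (C₁ C₂ : ℝ) : ℝ := (1 / 27) * (2 * C₁ + C₂) ^ 3

/-- The critical points of `U`. For `C₃ ≠ 0` the pole `C₁` is not among them, since `U` is not
continuous there. -/
def critSet (C₁ C₂ C₃ : ℝ) : Set ℝ := {φ | HasDerivAt (U C₁ C₂ C₃) 0 φ}

/-- The first critical point of `U` (the saddle): the one in `(-C₂/2, (C₁-C₂)/3)`. -/
def φ₁ (C₁ C₂ C₃ : ℝ) : ℝ := sInf (critSet C₁ C₂ C₃ ∩ Set.Ioo (-C₂ / 2) ((C₁ - C₂) / 3))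

/-- The second critical point of `U` (the center): the one in `((C₁-C₂)/3, C₁)`. -/
def φ₂ (C₁ C₂ C₃ : ℝ) : ℝ := sInf (critSet C₁ C₂ C₃ ∩ Set.Ioo ((C₁ - C₂) / 3) C₁)

/-- The third critical point of `U`: the one in `(C₁, ∞)`. -/
def φ₃ (C₁ C₂ C₃ : ℝ) : ℝ := sInf (critSet C₁ C₂ C₃ ∩ Set.Ioi C₁)

/-- The energy `b₋` of the center. -/
def bMinus (C₁ C₂ C₃ : ℝ) : ℝ := U C₁ C₂ C₃ (φ₂ C₁ C₂ C₃)

/-- The energy `b₊` of the saddle, i.e. of the homoclinic orbit. -/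
def bPlus (C₁ C₂ C₃ : ℝ) : ℝ := U C₁ C₂ C₃ (φ₁ C₁ C₂ C₃)

/-- The left turning point `φ₋` at energy `b`: the solution of `U φ = b` in `(φ₁, φ₂)`. -/
def φMinus (C₁ C₂ C₃ b : ℝ) : ℝ :=
  sInf {φ | φ ∈ Set.Ioo (φ₁ C₁ C₂ C₃) (φ₂ C₁ C₂ C₃) ∧ U C₁ C₂ C₃ φ = b}

/-- The right turning point `φ₊` at energy `b`: the solution of `U φ = b` in `(φ₂, C₁)`. -/
def φPlus (C₁ C₂ C₃ b : ℝ) : ℝ :=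
  sInf {φ | φ ∈ Set.Ioo (φ₂ C₁ C₂ C₃) C₁ ∧ U C₁ C₂ C₃ φ = b}

/-- The integrand of the period function. -/
def periodIntegrand (C₁ C₂ C₃ b φ : ℝ) : ℝ := Real.sqrt (1 / (2 * (b - U C₁ C₂ C₃ φ)))

/-- The period function of the smooth periodic waves. -/
def period (C₁ C₂ C₃ b : ℝ) : ℝ :=
  2 * ∫ φ in (φMinus C₁ C₂ C₃ b)..(φPlus C₁ C₂ C₃ b), periodIntegrand C₁ C₂ C₃ b φ

end

end DGH

/-! In the coordinate `x = C₁ - φ`, the quantity `2 x (b - U)` is the cubic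
`x³ - (2 C₁ + C₂) x² + (2 b + C₁² + 2 C₁ C₂) x - C₃ = (x - p) (x - q) (x - r)`, whose linear
coefficient alone depends on `b`. Hence raising `b` moves `p` down, `q` up, `r` down, and
`p q = C₃ / r` up. The substitution `x = (p + q) / 2 + (q - p) / 2 * cos θ` turns half the period
into `∫ θ in 0..π, √(x / (r - x))`. This integrand need not increase pointwise with `b`, but its sum
over the pair `θ`, `π - θ` does, because both the larger term and the product of the two terms
increase. -/

namespace DGH

open Set MeasureTheory Real Filter Topology

lemma add_lt_add_of_mul_lt_mul {R : Type*} [CommRing R] [LinearOrder R] [IsStrictOrderedRing R]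
    {a b a' b' : R} (hb : 0 ≤ b) (hba : b ≤ a) (ha : a ≤ a') (h : a * b < a' * b') :
    a + b < a' + b' := by
  have ha' : 0 < a' := by
    refine ((hb.trans hba).trans ha).lt_of_ne fun h₀ => ?_
    have ha₀ : a = 0 := le_antisymm (ha.trans_eq h₀.symm) (hb.trans hba)
    simp [← h₀, ha₀] at h
  refine lt_of_mul_lt_mul_left ?_ ha'.le
  calc a' * (a + b) ≤ a' * (a + b) + (a' - a) * (a' - b) :=
        le_add_of_nonneg_right (mul_nonneg (sub_nonneg.2 ha) (sub_nonneg.2 (hba.trans ha)))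
    _ = a' * a' + a * b := by ring
    _ < a' * a' + a' * b' := by gcongr
    _ = a' * (a' + b') := by ring

lemma cubic_eq_mul_of_roots {R : Type*} [CommRing R] [IsDomain R] {s e c p q : R} (hpq : p ≠ q)
    (hp : p ^ 3 - s * p ^ 2 + e * p - c = 0) (hq : q ^ 3 - s * q ^ 2 + e * q - c = 0) (x : R) :
    x ^ 3 - s * x ^ 2 + e * x - c = (x - p) * (x - q) * (x - (s - p - q)) := by
  refine mul_left_cancel₀ (sub_ne_zero.2 hpq) ?_
  linear_combination (x - q) * hp - (x - p) * hq

lemma exists_cubic_eq_mul {s c : ℝ} (hc : 0 < c) (hcs : c < 4 / 27 * s ^ 3) :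
    ∃ u v w, w < 0 ∧ 0 < v ∧ v < 2 / 3 * s ∧ 2 / 3 * s < u ∧ u < s ∧
      ∀ x, x ^ 3 - s * x ^ 2 + c = (x - u) * (x - v) * (x - w) := by
  have hs : 0 < s := (Odd.pow_pos_iff (by decide : Odd 3)).1 (by linarith)
  have hcont : Continuous fun x : ℝ => x ^ 3 - s * x ^ 2 + c := by fun_prop
  have hmin : (2 / 3 * s) ^ 3 - s * (2 / 3 * s) ^ 2 + c < 0 := by linarith
  obtain ⟨v, ⟨hv₀, hvs⟩, hv⟩ := intermediate_value_Ioo' (by linarith : 0 ≤ 2 / 3 * s)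
    hcont.continuousOn ⟨hmin, by linarith⟩
  obtain ⟨u, ⟨hsu, hus⟩, hu⟩ := intermediate_value_Ioo (by linarith : 2 / 3 * s ≤ s)
    hcont.continuousOn ⟨hmin, by linarith⟩
  have hfac : ∀ x, x ^ 3 - s * x ^ 2 + c = (x - u) * (x - v) * (x - (s - u - v)) := fun x => by
    have := cubic_eq_mul_of_roots (s := s) (e := 0) (c := -c) (hvs.trans hsu).ne'
      (by linear_combination hu) (by linear_combination hv) x
    linear_combination this
  have hprod : u * v * (s - u - v) < 0 := by linarith [hfac 0]
  have huv : 0 < u * v := mul_pos (by linarith) hv₀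
  exact ⟨u, v, s - u - v, neg_of_mul_neg_right hprod huv.le, hv₀, hvs, hsu, hus, hfac⟩

-- The primed cubic is the larger one for `x > 0`, so its signs at `p` and `q`, and the sign of the
-- other one at `r'`, locate the roots.
lemma cubic_roots_nested {R : Type*} [CommRing R] [LinearOrder R] [IsStrictOrderedRing R]
    {p q r p' q' r' : R} (hp : 0 < p) (hpq : p < q) (hqr : q < r) (hpq' : p' < q')
    (hqr' : q' < r') (hsum : p + q + r = p' + q' + r') (hprod : p * q * r = p' * q' * r')
    (hpairs : p * q + q * r + r * p < p' * q' + q' * r' + r' * p') :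
    p' < p ∧ q < q' ∧ r' < r := by
  have hlt : ∀ x, 0 < x →
      (x - p) * (x - q) * (x - r) < (x - p') * (x - q') * (x - r') := fun x hx => by
    linear_combination x * hpairs - x ^ 2 * hsum - hprod
  have hpr' : p < r' := by linarith
  have hr'_neg : (r' - q) * (r' - r) < 0 := by
    have := hlt r' (hp.trans hpr')
    rw [sub_self, mul_zero, mul_assoc] at this
    exact neg_of_mul_neg_right this (sub_pos.2 hpr').le
  obtain ⟨hq_lt, hr'_lt⟩ := (sub_mul_sub_neg_iff _ hqr.le).1 hr'_neg
  have hbetween : ∀ x, x < r' → 0 < (x - p') * (x - q') * (x - r') → p' < x ∧ x < q' :=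
    fun x hx h => (sub_mul_sub_neg_iff _ hpq'.le).1
      (neg_of_mul_pos_left h (sub_neg.2 hx).le)
  have hp'p := hbetween p hpr' (by simpa using hlt p hp)
  have hq'q := hbetween q hq_lt (by simpa using hlt q (hp.trans hpq))
  exact ⟨hp'p.1, hq'q.2, hr'_lt⟩

lemma sInf_eq_of_forall_eq {α : Type*} [ConditionallyCompleteLattice α] {s : Set α} {x : α}
    (hx : x ∈ s) (h : ∀ y ∈ s, y = x) : sInf s = x := by
  rw [eq_singleton_iff_unique_mem.2 ⟨hx, h⟩, csInf_singleton]

lemma sInf_mem_of_injOn {α β : Type*} [ConditionallyCompleteLattice α] {f : α → β} {s : Set α}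
    {y : β} (hf : InjOn f s) (hy : y ∈ f '' s) :
    sInf {x | x ∈ s ∧ f x = y} ∈ {x | x ∈ s ∧ f x = y} := by
  obtain ⟨x, hx, rfl⟩ := hy
  have hx' : x ∈ {z | z ∈ s ∧ f z = f x} := ⟨hx, rfl⟩
  rwa [sInf_eq_of_forall_eq hx' fun z hz => hf hz.1 hx hz.2]

section Well

variable {α β : Type*} [LinearOrder α] [Preorder β] {f : α → β} {a c d l r x : α}

lemma lt_of_mem_Ioo_of_well (hanti : StrictAntiOn f (Icc a c)) (hmono : StrictMonoOn f (Ico c d))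
    (hl : l ∈ Icc a c) (hr : r ∈ Ico c d) (hlr : f l = f r) (hx : x ∈ Ioo l r) : f x < f l := by
  rcases le_total x c with hxc | hcx
  · exact hanti hl ⟨hl.1.trans hx.1.le, hxc⟩ hx.1
  · exact hlr ▸ hmono ⟨hcx, hx.2.trans hr.2⟩ hr hx.2

lemma setOf_eq_pair_of_well (hanti : StrictAntiOn f (Icc a c)) (hmono : StrictMonoOn f (Ico c d))
    (hl : l ∈ Ioo a c) (hr : r ∈ Ioo c d) (hlr : f l = f r) :
    {x | x ∈ Ioo a d ∧ f x = f l} = {l, r} := by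
  ext x
  constructor
  · rintro ⟨hx, hfx⟩
    rcases le_total x c with hxc | hcx
    · exact .inl (hanti.injOn ⟨hx.1.le, hxc⟩ (Ioo_subset_Icc_self hl) hfx)
    · exact .inr (hmono.injOn ⟨hcx, hx.2⟩ (Ioo_subset_Ico_self hr) (hfx.trans hlr))
  · rintro (rfl | rfl)
    · exact ⟨⟨hl.1, hl.2.trans (hr.1.trans hr.2)⟩, rfl⟩
    · exact ⟨⟨hl.1.trans (hl.2.trans hr.1), hr.2⟩, hlr.symm⟩

end Well

/-- The orthogonal projection to the diameter `[p, q]` of the point at angle `θ` of a circle. As a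
substitution it removes the inverse square root singularities at both ends of `[p, q]`. -/
noncomputable def chordPoint (p q θ : ℝ) : ℝ := (p + q) / 2 + (q - p) / 2 * cos θ

section ChordPoint

variable {p q : ℝ}

@[fun_prop]
lemma continuous_chordPoint (p q : ℝ) : Continuous (chordPoint p q) := by
  unfold chordPoint; fun_prop

lemma hasDerivAt_chordPoint (p q θ : ℝ) :
    HasDerivAt (chordPoint p q) (-((q - p) / 2 * sin θ)) θ :=
  (((hasDerivAt_cos θ).const_mul ((q - p) / 2)).const_add ((p + q) / 2)).congr_deriv
    (mul_neg _ _)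

lemma chordPoint_mem_Icc (hpq : p ≤ q) (θ : ℝ) : chordPoint p q θ ∈ Icc p q := by
  have hl := mul_nonneg (sub_nonneg.2 hpq) (sub_nonneg.2 (neg_one_le_cos θ))
  have hr := mul_nonneg (sub_nonneg.2 hpq) (sub_nonneg.2 (cos_le_one θ))
  constructor <;> (rw [chordPoint]; linarith)

lemma chordPoint_sub_mul_sub_chordPoint (p q θ : ℝ) :
    (chordPoint p q θ - p) * (q - chordPoint p q θ) = ((q - p) / 2 * sin θ) ^ 2 := by
  rw [chordPoint, mul_pow, sin_sq]; ring

lemma strictAntiOn_chordPoint (hpq : p < q) : StrictAntiOn (chordPoint p q) (Icc 0 π) :=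
  fun _ hx _ hy hxy => by
    have : 0 < (q - p) / 2 := half_pos (sub_pos.2 hpq)
    unfold chordPoint
    gcongr
    exact strictAntiOn_cos hx hy hxy

lemma image_chordPoint_Ioo (hpq : p < q) : chordPoint p q '' Ioo 0 π = Ioo p q := by
  have hcos : cos '' Ioo 0 π = Ioo (-1) 1 := cosPartialHomeomorph.image_source_eq_target
  have hh : 0 < (q - p) / 2 := half_pos (sub_pos.2 hpq)
  have : chordPoint p q = (fun x => (q - p) / 2 * x + (p + q) / 2) ∘ cos :=
    funext fun θ => add_comm _ _
  rw [this, image_comp, hcos, image_affine_Ioo hh]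
  congr 1 <;> ring

lemma abs_deriv_chordPoint_smul {θ : ℝ} (hpq : p < q) (hθ : θ ∈ Ioo 0 π) (g : ℝ → ℝ) :
    |(-((q - p) / 2 * sin θ))| • ((√((chordPoint p q θ - p) * (q - chordPoint p q θ)))⁻¹ *
      g (chordPoint p q θ)) = g (chordPoint p q θ) := by
  have h : 0 < (q - p) / 2 * sin θ :=
    mul_pos (half_pos (sub_pos.2 hpq)) (sin_pos_of_mem_Ioo hθ)
  rw [chordPoint_sub_mul_sub_chordPoint, sqrt_sq h.le, abs_neg, abs_of_pos h, smul_eq_mul,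
    mul_inv_cancel_left₀ h.ne']

lemma intervalIntegrable_inv_sqrt_mul_iff (hpq : p < q) (g : ℝ → ℝ) :
    IntervalIntegrable (fun x => (√((x - p) * (q - x)))⁻¹ * g x) volume p q ↔
      IntervalIntegrable (fun θ => g (chordPoint p q θ)) volume 0 π := by
  rw [intervalIntegrable_iff_integrableOn_Ioo_of_le hpq.le, ← image_chordPoint_Ioo hpq,
    integrableOn_image_iff_integrableOn_abs_deriv_smul measurableSet_Ioo
      (fun θ _ => (hasDerivAt_chordPoint p q θ).hasDerivWithinAt)
      ((strictAntiOn_chordPoint hpq).injOn.mono Ioo_subset_Icc_self),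
    intervalIntegrable_iff_integrableOn_Ioo_of_le pi_pos.le]
  exact integrableOn_congr_fun (fun θ hθ => abs_deriv_chordPoint_smul hpq hθ g) measurableSet_Ioo

lemma integral_inv_sqrt_mul (hpq : p < q) (g : ℝ → ℝ) :
    ∫ x in p..q, (√((x - p) * (q - x)))⁻¹ * g x = ∫ θ in 0..π, g (chordPoint p q θ) := by
  rw [intervalIntegral.integral_of_le hpq.le, integral_Ioc_eq_integral_Ioo,
    ← image_chordPoint_Ioo hpq, integral_image_eq_integral_abs_deriv_smul measurableSet_Ioo
      (fun θ _ => (hasDerivAt_chordPoint p q θ).hasDerivWithinAt)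
      ((strictAntiOn_chordPoint hpq).injOn.mono Ioo_subset_Icc_self),
    intervalIntegral.integral_of_le pi_pos.le, integral_Ioc_eq_integral_Ioo]
  exact setIntegral_congr_fun measurableSet_Ioo fun θ hθ => abs_deriv_chordPoint_smul hpq hθ g

lemma chordPoint_mul_chordPoint_pi_sub (p q θ : ℝ) :
    chordPoint p q θ * chordPoint p q (π - θ) = p * q + ((q - p) / 2 * sin θ) ^ 2 := by
  rw [chordPoint, chordPoint, cos_pi_sub, mul_pow, sin_sq]; ring

lemma sub_chordPoint_mul_sub_chordPoint_pi_sub (p q r θ : ℝ) :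
    (r - chordPoint p q θ) * (r - chordPoint p q (π - θ)) =
      (r - (p + q) / 2) ^ 2 - ((q - p) / 2 * cos θ) ^ 2 := by
  rw [chordPoint, chordPoint, cos_pi_sub]; ring

end ChordPoint

lemma intervalIntegral_eq_integral_add_comp_sub {E : Type*} [NormedAddCommGroup E]
    [NormedSpace ℝ E] {f : ℝ → E} {a b : ℝ} (hf : IntervalIntegrable f volume a b) :
    ∫ x in a..b, f x = ∫ x in a..((a + b) / 2), (f x + f (a + b - x)) := by
  have hm : (a + b) / 2 ∈ uIcc a b := by
    rcases le_total a b with h | h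
    · exact mem_uIcc_of_le (by linarith) (by linarith)
    · exact mem_uIcc_of_ge (by linarith) (by linarith)
  have hl := hf.mono_set (uIcc_subset_uIcc_left hm)
  have hr := hf.mono_set (uIcc_subset_uIcc_right hm)
  have hr' : IntervalIntegrable (fun x => f (a + b - x)) volume a ((a + b) / 2) := by
    convert! (hr.comp_sub_left (a + b)).symm using 1 <;> ring
  rw [intervalIntegral.integral_add hl hr', intervalIntegral.integral_comp_sub_left,
    add_sub_cancel_left, show a + b - (a + b) / 2 = (a + b) / 2 by ring,
    intervalIntegral.integral_add_adjacent_intervals hl hr]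

lemma sqrt_div_sub_add_lt {u v r u' v' r' : ℝ} (hv : 0 ≤ v) (hvu : v ≤ u) (huu' : u ≤ u')
    (hur' : u' < r') (hr : r' ≤ r) (hv' : 0 ≤ v') (hvr' : v' < r') (hmul : u * v < u' * v')
    (hsub : (r' - u') * (r' - v') ≤ (r - u) * (r - v)) :
    √(u / (r - u)) + √(v / (r - v)) < √(u' / (r' - u')) + √(v' / (r' - v')) := by
  have hu : 0 ≤ u := hv.trans hvu
  have hu' : 0 ≤ u' := hu.trans huu'
  have hru' : 0 < r' - u' := sub_pos.2 hur'
  have hrv' : 0 < r' - v' := sub_pos.2 hvr'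
  have hru : 0 < r - u := by linarith
  have hrv : 0 < r - v := by linarith
  refine add_lt_add_of_mul_lt_mul (sqrt_nonneg _) (by gcongr) (by gcongr) ?_
  rw [← sqrt_mul (div_nonneg hu hru.le), ← sqrt_mul (div_nonneg hu' hru'.le),
    div_mul_div_comm, div_mul_div_comm]
  exact sqrt_lt_sqrt (by positivity)
    (div_lt_div₀ hmul hsub (mul_nonneg hu' hv') (mul_pos hru' hrv'))

section CubicPeriod

variable {p q r p' q' r' : ℝ}

lemma sqrt_chordPoint_add_lt (hp' : 0 ≤ p') (hp : p' ≤ p) (hpq : p ≤ q) (hq : q ≤ q')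
    (hqr' : q' < r') (hr : r' ≤ r) (hmul : p * q < p' * q') {θ : ℝ} (hθ : θ ∈ Icc 0 (π / 2)) :
    √(chordPoint p q θ / (r - chordPoint p q θ)) +
        √(chordPoint p q (π - θ) / (r - chordPoint p q (π - θ))) <
      √(chordPoint p' q' θ / (r' - chordPoint p' q' θ)) +
        √(chordPoint p' q' (π - θ) / (r' - chordPoint p' q' (π - θ))) := by
  have hcos : 0 ≤ cos θ := cos_nonneg_of_mem_Icc ⟨by linarith [hθ.1, pi_pos], hθ.2⟩
  have hwidth : (q - p) / 2 ≤ (q' - p') / 2 := by linarith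
  have hwidth₀ : 0 ≤ (q - p) / 2 := by linarith
  have hmid : (p + q) / 2 ≤ (p' + q') / 2 := by
    refine (sq_le_sq₀ (by linarith) (by linarith)).1 ?_
    calc ((p + q) / 2) ^ 2 = p * q + ((q - p) / 2) ^ 2 := by ring
      _ ≤ p' * q' + ((q' - p') / 2) ^ 2 := by gcongr
      _ = ((p' + q') / 2) ^ 2 := by ring
  have hpq' : p' ≤ q' := hp.trans (hpq.trans hq)
  refine sqrt_div_sub_add_lt ((hp'.trans hp).trans (chordPoint_mem_Icc hpq _).1) ?_ ?_
    ((chordPoint_mem_Icc hpq' _).2.trans_lt hqr') hr (hp'.trans (chordPoint_mem_Icc hpq' _).1)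
    ((chordPoint_mem_Icc hpq' _).2.trans_lt hqr') ?_ ?_
  · have := mul_nonneg hwidth₀ hcos
    rw [chordPoint, chordPoint, cos_pi_sub]
    linarith
  · unfold chordPoint
    gcongr
  · rw [chordPoint_mul_chordPoint_pi_sub, chordPoint_mul_chordPoint_pi_sub, mul_pow, mul_pow]
    exact add_lt_add_of_lt_of_le hmul (by gcongr)
  · rw [sub_chordPoint_mul_sub_chordPoint_pi_sub, sub_chordPoint_mul_sub_chordPoint_pi_sub]
    gcongr
    linarith

/-- Half the period of the motion between the turning points `p < q` whose kinetic energy is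
`(x - p) (q - x) (r - x) / (2 x)`. -/
noncomputable def cubicPeriod (p q r : ℝ) : ℝ :=
  ∫ x in p..q, √(x / ((x - p) * (q - x) * (r - x)))

lemma sqrt_div_cubic_eq {x : ℝ} (hx : x ∈ Icc p q) :
    √(x / ((x - p) * (q - x) * (r - x))) = (√((x - p) * (q - x)))⁻¹ * √(x / (r - x)) := by
  have h : 0 ≤ (x - p) * (q - x) := mul_nonneg (sub_nonneg.2 hx.1) (sub_nonneg.2 hx.2)
  rw [← sqrt_inv, ← sqrt_mul (inv_nonneg.2 h), inv_mul_eq_div, div_div, mul_comm (r - x)]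

lemma continuous_sqrt_chordPoint_div (hpq : p ≤ q) (hqr : q < r) :
    Continuous fun θ => √(chordPoint p q θ / (r - chordPoint p q θ)) := by
  refine ((continuous_chordPoint p q).div (by fun_prop) fun θ => ?_).sqrt
  exact (sub_pos.2 ((chordPoint_mem_Icc hpq θ).2.trans_lt hqr)).ne'

lemma intervalIntegrable_sqrt_div_cubic (hpq : p < q) (hqr : q < r) :
    IntervalIntegrable (fun x => √(x / ((x - p) * (q - x) * (r - x)))) volume p q := by
  refine ((intervalIntegrable_inv_sqrt_mul_iff hpq fun x => √(x / (r - x))).2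
    ((continuous_sqrt_chordPoint_div hpq.le hqr).intervalIntegrable _ _)).congr_uIoo fun x hx => ?_
  exact (sqrt_div_cubic_eq (Ioo_subset_Icc_self (uIoo_of_le hpq.le ▸ hx))).symm

lemma cubicPeriod_eq_integral_half (hpq : p < q) (hqr : q < r) :
    cubicPeriod p q r = ∫ θ in 0..π / 2, (√(chordPoint p q θ / (r - chordPoint p q θ)) +
      √(chordPoint p q (π - θ) / (r - chordPoint p q (π - θ)))) := by
  calc cubicPeriod p q r
      = ∫ x in p..q, (√((x - p) * (q - x)))⁻¹ * √(x / (r - x)) :=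
        intervalIntegral.integral_congr_Ioo_of_le hpq.le fun x hx =>
          sqrt_div_cubic_eq (Ioo_subset_Icc_self hx)
    _ = ∫ θ in 0..π, √(chordPoint p q θ / (r - chordPoint p q θ)) :=
        integral_inv_sqrt_mul hpq fun x => √(x / (r - x))
    _ = _ := by
        simpa only [zero_add] using intervalIntegral_eq_integral_add_comp_sub
          ((continuous_sqrt_chordPoint_div hpq.le hqr).intervalIntegrable 0 π)

theorem cubicPeriod_lt_cubicPeriod (hp' : 0 ≤ p') (hp : p' ≤ p) (hpq : p < q) (hq : q ≤ q')
    (hqr' : q' < r') (hr : r' ≤ r) (hmul : p * q < p' * q') :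
    cubicPeriod p q r < cubicPeriod p' q' r' := by
  have hpq' : p' < q' := hp.trans_lt (hpq.trans_le hq)
  have hqr : q < r := hq.trans_lt (hqr'.trans_le hr)
  have hcont := continuous_sqrt_chordPoint_div hpq.le hqr
  have hcont' := continuous_sqrt_chordPoint_div hpq'.le hqr'
  have hlt := fun θ hθ => sqrt_chordPoint_add_lt hp' hp hpq.le hq hqr' hr hmul (θ := θ) hθ
  rw [cubicPeriod_eq_integral_half hpq hqr, cubicPeriod_eq_integral_half hpq' hqr']
  exact intervalIntegral.integral_lt_integral_of_continuousOn_of_le_of_exists_lt pi_div_two_pos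
    (hcont.add (hcont.comp (continuous_sub_left π))).continuousOn
    (hcont'.add (hcont'.comp (continuous_sub_left π))).continuousOn
    (fun θ hθ => (hlt θ (Ioc_subset_Icc_self hθ)).le)
    ⟨0, left_mem_Icc.2 pi_div_two_pos.le, hlt 0 (left_mem_Icc.2 pi_div_two_pos.le)⟩

end CubicPeriod

section Potential

variable {C₁ C₂ C₃ φ x : ℝ}

lemma two_mul_mul_sub_U (hx : x ≠ 0) (b : ℝ) :
    2 * x * (b - U C₁ C₂ C₃ (C₁ - x)) =
      x ^ 3 - (2 * C₁ + C₂) * x ^ 2 + (2 * b + C₁ ^ 2 + 2 * C₁ * C₂) * x - C₃ := by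
  rw [U, sub_sub_cancel_left]
  field_simp
  ring

lemma hasDerivAt_U (hφ : φ ≠ C₁) :
    HasDerivAt (U C₁ C₂ C₃)
      (((C₁ - φ) ^ 3 - (2 * C₁ + C₂) / 2 * (C₁ - φ) ^ 2 + C₃ / 2) / (C₁ - φ) ^ 2) φ := by
  have hφ' : φ - C₁ ≠ 0 := sub_ne_zero.2 hφ
  have hden : HasDerivAt (fun y : ℝ => 2 * (y - C₁)) (2 * 1) φ :=
    ((hasDerivAt_id φ).sub_const C₁).const_mul 2
  refine (((((hasDerivAt_pow 2 φ).const_mul (-(1 / 2))).sub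
    ((hasDerivAt_id φ).const_mul (1 / 2 * C₂))).sub_const (1 / 2 * C₁ * C₂)).sub
      ((hasDerivAt_const φ C₃).div hden (mul_ne_zero two_ne_zero hφ'))).congr_deriv ?_
  rw [← neg_sub φ C₁]
  field_simp
  ring

lemma continuousOn_U {s : Set ℝ} (hs : C₁ ∉ s) : ContinuousOn (U C₁ C₂ C₃) s :=
  fun _ hφ => (hasDerivAt_U (ne_of_mem_of_not_mem hφ hs)).continuousAt.continuousWithinAt

lemma not_continuousAt_U (hC₃ : C₃ ≠ 0) : ¬ ContinuousAt (U C₁ C₂ C₃) C₁ := by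
  intro hU
  have hlim := ContinuousAt.tendsto (x := C₁) (f := fun φ => 2 * (φ - C₁) *
    (-(1 / 2) * φ ^ 2 - 1 / 2 * C₂ * φ - 1 / 2 * C₁ * C₂ - U C₁ C₂ C₃ φ)) (by fun_prop)
  rw [sub_self, mul_zero, zero_mul] at hlim
  refine hC₃ (tendsto_nhds_unique_of_eventuallyEq tendsto_const_nhds
    (hlim.mono_left (nhdsWithin_le_nhds (s := {C₁}ᶜ))) ?_)
  filter_upwards [self_mem_nhdsWithin] with φ hφ
  rw [U, sub_sub_cancel, mul_div_cancel₀]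
  exact mul_ne_zero two_ne_zero (sub_ne_zero.2 hφ)

lemma tendsto_U_nhdsLT (hC₃ : 0 < C₃) : Tendsto (U C₁ C₂ C₃) (𝓝[<] C₁) atTop := by
  have hinv : Tendsto (fun φ => (C₁ - φ)⁻¹) (𝓝[<] C₁) atTop := by
    refine tendsto_inv_nhdsGT_zero.comp (tendsto_nhdsWithin_iff.2 ⟨?_, ?_⟩)
    · exact (Continuous.tendsto' (by fun_prop) _ _ (sub_self C₁)).mono_left nhdsWithin_le_nhds
    · filter_upwards [self_mem_nhdsWithin] with φ (hφ : φ < C₁) using sub_pos.2 hφ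
  have hpoly : Continuous fun φ => -(1 / 2) * φ ^ 2 - 1 / 2 * C₂ * φ - 1 / 2 * C₁ * C₂ := by
    fun_prop
  refine ((hpoly.tendsto C₁).mono_left nhdsWithin_le_nhds).add_atTop
    (hinv.const_mul_atTop (half_pos hC₃)) |>.congr fun φ => ?_
  rw [U, ← neg_sub φ C₁, inv_neg, mul_neg, ← sub_eq_add_neg, ← div_eq_mul_inv, div_div]

lemma mem_critSet_iff (hC₃ : C₃ ≠ 0) :
    φ ∈ critSet C₁ C₂ C₃ ↔ (C₁ - φ) ^ 3 - (2 * C₁ + C₂) / 2 * (C₁ - φ) ^ 2 + C₃ / 2 = 0 := by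
  change HasDerivAt (U C₁ C₂ C₃) 0 φ ↔ _
  rcases eq_or_ne φ C₁ with rfl | hφ
  · have hcubic : (φ - φ) ^ 3 - (2 * φ + C₂) / 2 * (φ - φ) ^ 2 + C₃ / 2 ≠ 0 := by simpa using hC₃
    exact iff_of_false (fun h => not_continuousAt_U hC₃ h.continuousAt) hcubic
  · have hsq : (C₁ - φ) ^ 2 ≠ 0 := pow_ne_zero 2 (sub_ne_zero.2 hφ.symm)
    have hderiv := hasDerivAt_U (C₂ := C₂) (C₃ := C₃) hφ
    refine ⟨fun h => ?_, fun h => by rwa [h, zero_div] at hderiv⟩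
    exact (div_eq_zero_iff.1 (hderiv.unique h)).resolve_right hsq

end Potential

section CriticalPoints

variable {C₁ C₂ C₃ : ℝ}

lemma critical_points_spec (hC₃ : C₃ ∈ Ioo 0 (C₃critical C₁ C₂)) :
    (-C₂ / 2 < φ₁ C₁ C₂ C₃ ∧ φ₁ C₁ C₂ C₃ < (C₁ - C₂) / 3 ∧ (C₁ - C₂) / 3 < φ₂ C₁ C₂ C₃ ∧
      φ₂ C₁ C₂ C₃ < C₁ ∧ C₁ < φ₃ C₁ C₂ C₃) ∧
    ∀ φ, (C₁ - φ) ^ 3 - (2 * C₁ + C₂) / 2 * (C₁ - φ) ^ 2 + C₃ / 2 =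
      -((φ - φ₁ C₁ C₂ C₃) * (φ - φ₂ C₁ C₂ C₃) * (φ - φ₃ C₁ C₂ C₃)) := by
  obtain ⟨u, v, w, hw, hv, hvs, hsu, hus, hfac⟩ :=
    exists_cubic_eq_mul (s := (2 * C₁ + C₂) / 2) (c := C₃ / 2) (half_pos hC₃.1)
      (by linarith [hC₃.2.trans_eq (C₃critical.eq_def C₁ C₂)])
  have hcrit : ∀ φ, φ ∈ critSet C₁ C₂ C₃ ↔ φ = C₁ - u ∨ φ = C₁ - v ∨ φ = C₁ - w := fun φ => by
    rw [mem_critSet_iff hC₃.1.ne', hfac, mul_eq_zero, mul_eq_zero, or_assoc, sub_eq_zero,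
      sub_eq_zero, sub_eq_zero]
    simp only [eq_sub_iff_add_eq, add_comm, eq_comm]
  have h₁ : φ₁ C₁ C₂ C₃ = C₁ - u := by
    refine sInf_eq_of_forall_eq ⟨(hcrit _).2 (.inl rfl), by constructor <;> linarith⟩ ?_
    rintro φ ⟨hφ, -, hφr⟩
    rcases (hcrit φ).1 hφ with h | h | h <;> linarith
  have h₂ : φ₂ C₁ C₂ C₃ = C₁ - v := by
    refine sInf_eq_of_forall_eq ⟨(hcrit _).2 (.inr (.inl rfl)), by constructor <;> linarith⟩ ?_
    rintro φ ⟨hφ, hφl, hφr⟩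
    rcases (hcrit φ).1 hφ with h | h | h <;> linarith
  have h₃ : φ₃ C₁ C₂ C₃ = C₁ - w := by
    refine sInf_eq_of_forall_eq ⟨(hcrit _).2 (.inr (.inr rfl)), show C₁ < C₁ - w by linarith⟩ ?_
    rintro φ ⟨hφ, hφl : C₁ < φ⟩
    rcases (hcrit φ).1 hφ with h | h | h <;> linarith
  rw [h₁, h₂, h₃]
  refine ⟨⟨?_, ?_, ?_, ?_, ?_⟩, fun φ => (hfac _).trans (by ring)⟩ <;> linarith

lemma critSet_eq (hC₃ : C₃ ∈ Ioo 0 (C₃critical C₁ C₂)) :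
    critSet C₁ C₂ C₃ = {φ₁ C₁ C₂ C₃, φ₂ C₁ C₂ C₃, φ₃ C₁ C₂ C₃} := by
  ext φ
  rw [mem_critSet_iff hC₃.1.ne', (critical_points_spec hC₃).2, neg_eq_zero, mul_eq_zero,
    mul_eq_zero, sub_eq_zero, sub_eq_zero, sub_eq_zero, or_assoc]
  rfl

lemma φ₁_lt_φ₂ (hC₃ : C₃ ∈ Ioo 0 (C₃critical C₁ C₂)) : φ₁ C₁ C₂ C₃ < φ₂ C₁ C₂ C₃ := by
  obtain ⟨⟨-, h₁, h₂, -⟩, -⟩ := critical_points_spec hC₃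
  exact h₁.trans h₂

lemma φ₂_lt_C₁ (hC₃ : C₃ ∈ Ioo 0 (C₃critical C₁ C₂)) : φ₂ C₁ C₂ C₃ < C₁ :=
  (critical_points_spec hC₃).1.2.2.2.1

lemma φ₁_lt_C₁ (hC₃ : C₃ ∈ Ioo 0 (C₃critical C₁ C₂)) : φ₁ C₁ C₂ C₃ < C₁ :=
  (φ₁_lt_φ₂ hC₃).trans (φ₂_lt_C₁ hC₃)

lemma exists_pos_deriv_U_eq_mul (hC₃ : C₃ ∈ Ioo 0 (C₃critical C₁ C₂)) {φ : ℝ} (hφ : φ < C₁) :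
    ∃ k, 0 < k ∧ deriv (U C₁ C₂ C₃) φ = (φ - φ₁ C₁ C₂ C₃) * (φ - φ₂ C₁ C₂ C₃) * k := by
  obtain ⟨⟨-, -, -, -, hφ₃⟩, hfac⟩ := critical_points_spec hC₃
  refine ⟨(φ₃ C₁ C₂ C₃ - φ) / (C₁ - φ) ^ 2,
    div_pos (sub_pos.2 (hφ.trans hφ₃)) (pow_pos (sub_pos.2 hφ) 2), ?_⟩
  rw [(hasDerivAt_U hφ.ne).deriv, hfac]
  ring

lemma strictAntiOn_U (hC₃ : C₃ ∈ Ioo 0 (C₃critical C₁ C₂)) :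
    StrictAntiOn (U C₁ C₂ C₃) (Icc (φ₁ C₁ C₂ C₃) (φ₂ C₁ C₂ C₃)) := by
  refine strictAntiOn_of_deriv_neg (convex_Icc _ _)
    (continuousOn_U fun h => h.2.not_gt (φ₂_lt_C₁ hC₃)) fun φ hφ => ?_
  rw [interior_Icc] at hφ
  obtain ⟨k, hk, hderiv⟩ := exists_pos_deriv_U_eq_mul hC₃ (hφ.2.trans (φ₂_lt_C₁ hC₃))
  rw [hderiv]
  exact mul_neg_of_neg_of_pos (mul_neg_of_pos_of_neg (sub_pos.2 hφ.1) (sub_neg.2 hφ.2)) hk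

lemma strictMonoOn_U (hC₃ : C₃ ∈ Ioo 0 (C₃critical C₁ C₂)) :
    StrictMonoOn (U C₁ C₂ C₃) (Ico (φ₂ C₁ C₂ C₃) C₁) := by
  refine strictMonoOn_of_deriv_pos (convex_Ico _ _)
    (continuousOn_U right_notMem_Ico) fun φ hφ => ?_
  rw [interior_Ico] at hφ
  obtain ⟨k, hk, hderiv⟩ := exists_pos_deriv_U_eq_mul hC₃ hφ.2
  rw [hderiv]
  exact mul_pos (mul_pos (sub_pos.2 ((φ₁_lt_φ₂ hC₃).trans hφ.1)) (sub_pos.2 hφ.1)) hk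

lemma bMinus_lt_bPlus (hC₃ : C₃ ∈ Ioo 0 (C₃critical C₁ C₂)) : bMinus C₁ C₂ C₃ < bPlus C₁ C₂ C₃ :=
  strictAntiOn_U hC₃ (left_mem_Icc.2 (φ₁_lt_φ₂ hC₃).le) (right_mem_Icc.2 (φ₁_lt_φ₂ hC₃).le)
    (φ₁_lt_φ₂ hC₃)

end CriticalPoints

section TurningPoints

variable {C₁ C₂ C₃ b : ℝ}

lemma φMinus_spec (hC₃ : C₃ ∈ Ioo 0 (C₃critical C₁ C₂))
    (hb : b ∈ Ioo (bMinus C₁ C₂ C₃) (bPlus C₁ C₂ C₃)) :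
    φMinus C₁ C₂ C₃ b ∈ Ioo (φ₁ C₁ C₂ C₃) (φ₂ C₁ C₂ C₃) ∧ U C₁ C₂ C₃ (φMinus C₁ C₂ C₃ b) = b :=
  sInf_mem_of_injOn ((strictAntiOn_U hC₃).injOn.mono Ioo_subset_Icc_self)
    (intermediate_value_Ioo' (φ₁_lt_φ₂ hC₃).le
      (continuousOn_U fun h => h.2.not_gt (φ₂_lt_C₁ hC₃)) hb)

lemma φPlus_spec (hC₃ : C₃ ∈ Ioo 0 (C₃critical C₁ C₂)) (hb : bMinus C₁ C₂ C₃ < b) :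
    φPlus C₁ C₂ C₃ b ∈ Ioo (φ₂ C₁ C₂ C₃) C₁ ∧ U C₁ C₂ C₃ (φPlus C₁ C₂ C₃ b) = b := by
  have hφ₂ := φ₂_lt_C₁ hC₃
  exact sInf_mem_of_injOn ((strictMonoOn_U hC₃).injOn.mono Ioo_subset_Ico_self)
    (isPreconnected_Ioo.intermediate_value_Ioi (le_principal_iff.2 (Ioo_mem_nhdsGT hφ₂))
      (le_principal_iff.2 (Ioo_mem_nhdsLT hφ₂)) (continuousOn_U right_notMem_Ioo)
      ((hasDerivAt_U hφ₂.ne).continuousAt.tendsto.mono_left nhdsWithin_le_nhds)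
      (tendsto_U_nhdsLT hC₃.1) hb)

lemma setOf_U_eq (hC₃ : C₃ ∈ Ioo 0 (C₃critical C₁ C₂))
    (hb : b ∈ Ioo (bMinus C₁ C₂ C₃) (bPlus C₁ C₂ C₃)) :
    {φ | φ ∈ Ioo (φ₁ C₁ C₂ C₃) C₁ ∧ U C₁ C₂ C₃ φ = b} =
      {φMinus C₁ C₂ C₃ b, φPlus C₁ C₂ C₃ b} := by
  obtain ⟨hl, hUl⟩ := φMinus_spec hC₃ hb
  obtain ⟨hr, hUr⟩ := φPlus_spec hC₃ hb.1
  simpa only [hUl] using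
    setOf_eq_pair_of_well (strictAntiOn_U hC₃) (strictMonoOn_U hC₃) hl hr (hUl.trans hUr.symm)

lemma U_lt_of_mem_Ioo (hC₃ : C₃ ∈ Ioo 0 (C₃critical C₁ C₂))
    (hb : b ∈ Ioo (bMinus C₁ C₂ C₃) (bPlus C₁ C₂ C₃)) {φ : ℝ}
    (hφ : φ ∈ Ioo (φMinus C₁ C₂ C₃ b) (φPlus C₁ C₂ C₃ b)) : U C₁ C₂ C₃ φ < b := by
  obtain ⟨hl, hUl⟩ := φMinus_spec hC₃ hb
  obtain ⟨hr, hUr⟩ := φPlus_spec hC₃ hb.1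
  exact (lt_of_mem_Ioo_of_well (strictAntiOn_U hC₃) (strictMonoOn_U hC₃)
    (Ioo_subset_Icc_self hl) (Ioo_subset_Ico_self hr) (hUl.trans hUr.symm) hφ).trans_eq hUl

lemma exists_turning_roots (hC₃ : C₃ ∈ Ioo 0 (C₃critical C₁ C₂))
    (hb : b ∈ Ioo (bMinus C₁ C₂ C₃) (bPlus C₁ C₂ C₃)) :
    ∃ p q r, φPlus C₁ C₂ C₃ b = C₁ - p ∧ φMinus C₁ C₂ C₃ b = C₁ - q ∧
      0 < p ∧ p < q ∧ q < r ∧ p + q + r = 2 * C₁ + C₂ ∧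
      p * q + q * r + r * p = 2 * b + C₁ ^ 2 + 2 * C₁ * C₂ ∧ p * q * r = C₃ := by
  obtain ⟨⟨hφ₁q, hqφ₂⟩, hUq⟩ := φMinus_spec hC₃ hb
  obtain ⟨⟨hφ₂p, hpC₁⟩, hUp⟩ := φPlus_spec hC₃ hb.1
  obtain ⟨p, hp⟩ : ∃ p, φPlus C₁ C₂ C₃ b = C₁ - p := ⟨_, (sub_sub_cancel _ _).symm⟩
  obtain ⟨q, hq⟩ : ∃ q, φMinus C₁ C₂ C₃ b = C₁ - q := ⟨_, (sub_sub_cancel _ _).symm⟩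
  rw [hp] at hφ₂p hpC₁ hUp
  rw [hq] at hφ₁q hqφ₂ hUq
  have hp₀ : 0 < p := sub_lt_self_iff _ |>.1 hpC₁
  have hpq : p < q := sub_lt_sub_iff_left _ |>.1 (hqφ₂.trans hφ₂p)
  have hroot : ∀ x, 0 < x → U C₁ C₂ C₃ (C₁ - x) = b →
      x ^ 3 - (2 * C₁ + C₂) * x ^ 2 + (2 * b + C₁ ^ 2 + 2 * C₁ * C₂) * x - C₃ = 0 :=
    fun x hx hU => by rw [← two_mul_mul_sub_U hx.ne', hU, sub_self, mul_zero]
  have hfac := cubic_eq_mul_of_roots hpq.ne (hroot p hp₀ hUp) (hroot q (hp₀.trans hpq) hUq)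
  set r := 2 * C₁ + C₂ - p - q with hr
  have hprod : p * q * r = C₃ := by linear_combination hfac 0
  refine ⟨p, q, r, hp, hq, hp₀, hpq, ?_, by ring, by linear_combination hprod + hr - hfac 1, hprod⟩
  have hqx : q < C₁ - φ₁ C₁ C₂ C₃ := lt_sub_comm.1 hφ₁q
  have hx : 0 < C₁ - φ₁ C₁ C₂ C₃ := sub_pos.2 (φ₁_lt_C₁ hC₃)
  have hneg : (C₁ - φ₁ C₁ C₂ C₃ - p) * (C₁ - φ₁ C₁ C₂ C₃ - q) * (C₁ - φ₁ C₁ C₂ C₃ - r) < 0 := by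
    rw [← hfac, ← two_mul_mul_sub_U hx.ne', sub_sub_cancel]
    exact mul_neg_of_pos_of_neg (mul_pos two_pos hx) (sub_neg.2 hb.2)
  exact hqx.trans (sub_neg.1 (neg_of_mul_neg_right hneg
    (mul_pos (sub_pos.2 (hpq.trans hqx)) (sub_pos.2 hqx)).le))

end TurningPoints

section Period

variable {C₁ C₂ C₃ b p q r : ℝ}

lemma periodIntegrand_sub_eq (hsum : p + q + r = 2 * C₁ + C₂)
    (hpairs : p * q + q * r + r * p = 2 * b + C₁ ^ 2 + 2 * C₁ * C₂) (hprod : p * q * r = C₃)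
    {x : ℝ} (hx : x ≠ 0) :
    periodIntegrand C₁ C₂ C₃ b (C₁ - x) = √(x / ((x - p) * (q - x) * (r - x))) := by
  have hfac : x * (2 * (b - U C₁ C₂ C₃ (C₁ - x))) = (x - p) * (q - x) * (r - x) := by
    rw [mul_left_comm, ← mul_assoc, two_mul_mul_sub_U hx, ← hsum, ← hpairs, ← hprod]
    ring
  rw [periodIntegrand, ← hfac, div_mul_cancel_left₀ hx, one_div]

lemma intervalIntegrable_periodIntegrand (hp : 0 < p) (hpq : p < q) (hqr : q < r)
    (hsum : p + q + r = 2 * C₁ + C₂)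
    (hpairs : p * q + q * r + r * p = 2 * b + C₁ ^ 2 + 2 * C₁ * C₂) (hprod : p * q * r = C₃) :
    IntervalIntegrable (periodIntegrand C₁ C₂ C₃ b) volume (C₁ - q) (C₁ - p) := by
  have h : IntervalIntegrable (fun x => periodIntegrand C₁ C₂ C₃ b (C₁ - x)) volume p q :=
    (intervalIntegrable_sqrt_div_cubic hpq hqr).congr_uIoo fun x hx =>
      (periodIntegrand_sub_eq hsum hpairs hprod
        (hp.trans (uIoo_of_le hpq.le ▸ hx).1).ne').symm
  simpa only [sub_sub_cancel] using (h.comp_sub_left C₁).symm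

lemma integral_periodIntegrand (hp : 0 < p) (hpq : p < q) (hsum : p + q + r = 2 * C₁ + C₂)
    (hpairs : p * q + q * r + r * p = 2 * b + C₁ ^ 2 + 2 * C₁ * C₂) (hprod : p * q * r = C₃) :
    ∫ φ in (C₁ - q)..(C₁ - p), periodIntegrand C₁ C₂ C₃ b φ = cubicPeriod p q r := by
  rw [← intervalIntegral.integral_comp_sub_left]
  exact intervalIntegral.integral_congr_Ioo_of_le hpq.le fun x hx =>
    periodIntegrand_sub_eq hsum hpairs hprod (hp.trans hx.1).ne'

theorem strictMonoOn_period (hC₃ : C₃ ∈ Ioo 0 (C₃critical C₁ C₂)) :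
    StrictMonoOn (period C₁ C₂ C₃) (Ioo (bMinus C₁ C₂ C₃) (bPlus C₁ C₂ C₃)) := by
  intro b hb b' hb' hbb'
  obtain ⟨p, q, r, hφp, hφq, hp, hpq, hqr, hsum, hpairs, hprod⟩ := exists_turning_roots hC₃ hb
  obtain ⟨p', q', r', hφp', hφq', hp', hpq', hqr', hsum', hpairs', hprod'⟩ :=
    exists_turning_roots hC₃ hb'
  obtain ⟨hp'p, hqq', hr'r⟩ := cubic_roots_nested hp hpq hqr hpq' hqr' (hsum.trans hsum'.symm)
    (hprod.trans hprod'.symm) (by linarith)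
  have hmul : p * q < p' * q' := by
    refine lt_of_mul_lt_mul_right ?_ (hp.trans (hpq.trans hqr)).le
    calc p * q * r = p' * q' * r' := hprod.trans hprod'.symm
      _ < p' * q' * r := mul_lt_mul_of_pos_left hr'r (mul_pos hp' (hp'.trans hpq'))
  rw [period, period, hφp, hφq, hφp', hφq', integral_periodIntegrand hp hpq hsum hpairs hprod,
    integral_periodIntegrand hp' hpq' hsum' hpairs' hprod']
  exact mul_lt_mul_of_pos_left
    (cubicPeriod_lt_cubicPeriod hp'.le hp'p.le hpq hqq'.le hqr' hr'r.le hmul) two_pos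

end Period

end DGH

/-- For `2 C₁ + C₂ > 0` and `0 < C₃ < C₃critical` the smooth periodic waves are parameterized by
`b ∈ (b₋, b₊)`, and their period function is strictly increasing in `b`. The first three parts say
that the objects entering the period function are what their definitions announce (critical
points, non-degenerate energy range, turning points, convergent integral). -/
theorem theorem2 (C₁ C₂ C₃ : ℝ) (hC : 0 < 2 * C₁ + C₂)
    (hC₃ : C₃ ∈ Set.Ioo 0 (DGH.C₃critical C₁ C₂)) :
    (DGH.critSet C₁ C₂ C₃ = {DGH.φ₁ C₁ C₂ C₃, DGH.φ₂ C₁ C₂ C₃, DGH.φ₃ C₁ C₂ C₃} ∧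
      -C₂ / 2 < DGH.φ₁ C₁ C₂ C₃ ∧ DGH.φ₁ C₁ C₂ C₃ < (C₁ - C₂) / 3 ∧
      (C₁ - C₂) / 3 < DGH.φ₂ C₁ C₂ C₃ ∧ DGH.φ₂ C₁ C₂ C₃ < C₁ ∧ C₁ < DGH.φ₃ C₁ C₂ C₃) ∧
    DGH.bMinus C₁ C₂ C₃ < DGH.bPlus C₁ C₂ C₃ ∧
    (∀ b ∈ Set.Ioo (DGH.bMinus C₁ C₂ C₃) (DGH.bPlus C₁ C₂ C₃),
      {φ | φ ∈ Set.Ioo (DGH.φ₁ C₁ C₂ C₃) C₁ ∧ DGH.U C₁ C₂ C₃ φ = b}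
          = {DGH.φMinus C₁ C₂ C₃ b, DGH.φPlus C₁ C₂ C₃ b} ∧
        DGH.φ₁ C₁ C₂ C₃ < DGH.φMinus C₁ C₂ C₃ b ∧
        DGH.φMinus C₁ C₂ C₃ b < DGH.φ₂ C₁ C₂ C₃ ∧
        DGH.φ₂ C₁ C₂ C₃ < DGH.φPlus C₁ C₂ C₃ b ∧
        DGH.φPlus C₁ C₂ C₃ b < C₁ ∧
        (∀ φ ∈ Set.Ioo (DGH.φMinus C₁ C₂ C₃ b) (DGH.φPlus C₁ C₂ C₃ b),
          DGH.U C₁ C₂ C₃ φ < b) ∧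
        IntervalIntegrable (DGH.periodIntegrand C₁ C₂ C₃ b) MeasureTheory.volume
          (DGH.φMinus C₁ C₂ C₃ b) (DGH.φPlus C₁ C₂ C₃ b)) ∧
    StrictMonoOn (DGH.period C₁ C₂ C₃)
      (Set.Ioo (DGH.bMinus C₁ C₂ C₃) (DGH.bPlus C₁ C₂ C₃)) := by
  refine ⟨⟨DGH.critSet_eq hC₃, (DGH.critical_points_spec hC₃).1⟩, DGH.bMinus_lt_bPlus hC₃,
    fun b hb => ?_, DGH.strictMonoOn_period hC₃⟩
  obtain ⟨⟨hφ₁, hl⟩, -⟩ := DGH.φMinus_spec hC₃ hb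
  obtain ⟨⟨hr, hC₁⟩, -⟩ := DGH.φPlus_spec hC₃ hb.1
  refine ⟨DGH.setOf_U_eq hC₃ hb, hφ₁, hl, hr, hC₁, fun φ => DGH.U_lt_of_mem_Ioo hC₃ hb, ?_⟩
  obtain ⟨p, q, r, hφp, hφq, hp, hpq, hqr, hsum, hpairs, hprod⟩ := DGH.exists_turning_roots hC₃ hb
  rw [hφp, hφq]
  exact DGH.intervalIntegrable_periodIntegrand hp hpq hqr hsum hpairs hprod
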